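/- Let $X$ (phase space) and $K$ (parameter space) be compact metric spaces with metrics $\rho,\rho_K$, and let $f:[0,\infty)\times X\times K\to X$ be continuous, such that every $f(t,\cdot,k)$ is a homeomorphism of $X$ onto a subset of $X$, $f(0,x,k)=x$ and $f(t,f(t',x,k),k)=f(t+t',x,k)$ for all $t,t'\ge 0$, $x\in X$, $k\in K$. Fix $T>0$. For $\varepsilon>0$, a $(k,x,\varepsilon)$-motion is a (not necessarily continuous) mapping $\varphi:[0,\infty)\to X$ with $\varphi(0)=x$ and $\rho(\varphi(t+\tau),f(\tau,\varphi(t),k))<\varepsilon$ for all $t\ge 0$, $\tau\in[0,T]$. A point $y$ is an $\omega$-limit point of $\varphi$ if $\varphi(t_i)\to y$ for some sequence $t_i\to\infty$. Let $\omega^\varepsilon(x,k)$ be the set of all $\omega$-limit points of all $(k,x,\varepsilon)$-motions, and $\omega^0(x,k)=\bigcap_{\varepsilon>0}\omega^\varepsilon(x,k)$. With $\rho^*(z,P)=\inf_{y\in P}\rho(z,y)$ put, for $\gamma>0$ and a $(k,x,\varepsilon)$-motion $\varphi$, $$\tau_3^\varepsilon(\varphi,\gamma)=\inf\{t\ge 0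 \mid \rho^*(\varphi(t'),\omega^\varepsilon(x,k))<\gamma\ \text{for all}\ t'>t\}.$$ The system possesses $\tau_3^0$-slow relaxations if there are $\gamma>0$ and sequences $\varepsilon_j>0$, $\varepsilon_j\to 0$, $(x_j,k_j)\in X\times K$, and $(k_j,x_j,\varepsilon_j)$-motions $\varphi_j$ such that $\tau_3^{\varepsilon_j}(\varphi_j,\gamma)\to\infty$. It possesses $\omega^0(x,k)$-bifurcations if the set-valued function $(x,k)\mapsto\omega^0(x,k)$ is not lower semicontinuous on $X\times K$, where lower semicontinuity at $(x_0,k_0)$ means $d(\omega^0(x_0,k_0),\omega^0(x,k))\to 0$ as $(x,k)\to(x_0,k_0)$, with $d(p,q)=\sup_{x\in p}\rho^*(x,q)$. **Theorem.** (a) If the system possesses $\tau_3^0$-slow relaxations, then it possesses $\omega^0(x,k)$-bifurcations. (b) If $X$ is connected, then the system possesses $\tau_3^0$-slow relaxations if and only if it possesses $\omega^0(x,k)$-bifurcations. -/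

import Mathlib

open Set Filter Topology
open scoped NNReal ENNReal

/-- A family of semiflows of homeomorphisms on the phase space `X`, depending on a parameter in `K`:
a jointly continuous map `f : [0, ∞) × X × K → X` such that every `f(t, ·, k)` is a homeomorphism of
`X` onto a subset of `X`, `f(0, ·, k) = id` and `f(t, f(t', x, k), k) = f(t + t', x, k)`. -/
structure SemiflowFamily (X K : Type*) [MetricSpace X] [MetricSpace K] where
  /-- the shift over the time `t ≥ 0` -/
  f : ℝ≥0 → X → K → X
  continuous_f : Continuous fun p : ℝ≥0 × X × K => f p.1 p.2.1 p.2.2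
  isEmbedding_f : ∀ t k, IsEmbedding fun x => f t x k
  f_zero : ∀ x k, f 0 x k = x
  f_add : ∀ t t' x k, f t (f t' x k) k = f (t + t') x k

/-- The set of `ω`-limit points of a mapping `φ : [0, ∞) → X` (not assumed continuous). -/
def omegaLimitPoints {X : Type*} [MetricSpace X] (φ : ℝ≥0 → X) : Set X :=
  {y | ∃ t : ℕ → ℝ≥0, Tendsto t atTop atTop ∧ Tendsto (fun i => φ (t i)) atTop (𝓝 y)}

/-- The one-sided proximity `d(p, q) = sup_{x ∈ p} inf_{y ∈ q} ρ(x, y)` of subsets of `X`. -/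
noncomputable def setProximity {X : Type*} [MetricSpace X] (p q : Set X) : ℝ≥0∞ :=
  ⨆ x ∈ p, Metric.infEDist x q

/-- Lower semicontinuity (`d`-continuity) of a set-valued function at a point:
`d(F z₀, F z) → 0` as `z → z₀`. -/
def LowerSemicontAt {Z X : Type*} [TopologicalSpace Z] [MetricSpace X]
    (F : Z → Set X) (z₀ : Z) : Prop :=
  Tendsto (fun z => setProximity (F z₀) (F z)) (𝓝 z₀) (𝓝 0)

namespace SemiflowFamily

variable {X K : Type*} [MetricSpace X] [MetricSpace K]

/-- `φ` is a `(k, x, ε, T)`-motion of the system: `φ(0) = x`, and during any time interval of length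
at most `T` it departs from the true motion by less than `ε`. It need not be continuous. -/
def IsEpsMotion (S : SemiflowFamily X K) (T : ℝ≥0) (k : K) (x : X) (ε : ℝ) (φ : ℝ≥0 → X) : Prop :=
  φ 0 = x ∧ ∀ t τ : ℝ≥0, τ ≤ T → dist (φ (t + τ)) (S.f τ (φ t) k) < ε

/-- `ω^ε(x, k)`: all `ω`-limit points of all `(k, x, ε, T)`-motions. -/
def omegaEps (S : SemiflowFamily X K) (T : ℝ≥0) (ε : ℝ) (x : X) (k : K) : Set X :=
  {y | ∃ φ : ℝ≥0 → X, S.IsEpsMotion T k x ε φ ∧ y ∈ omegaLimitPoints φ}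

/-- `ω⁰(x, k) = ⋂_{ε > 0} ω^ε(x, k)`. -/
def omegaZero (S : SemiflowFamily X K) (T : ℝ≥0) (x : X) (k : K) : Set X :=
  ⋂ (ε : ℝ) (_ : 0 < ε), S.omegaEps T ε x k

/-- The time of final entry of a `(k, x, ε, T)`-motion `φ` into the `γ`-neighbourhood of `ω^ε(x, k)`:
`τ₃^ε(φ, γ) = inf {t ≥ 0 | ρ*(φ(t'), ω^ε(x, k)) < γ for all t' > t}`. -/
noncomputable def tauThree (S : SemiflowFamily X K) (T : ℝ≥0) (ε : ℝ) (x : X) (k : K)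
    (φ : ℝ≥0 → X) (γ : ℝ) : ℝ≥0∞ :=
  ⨅ (t : ℝ≥0) (_ : ∀ t' : ℝ≥0, t < t' →
    Metric.infEDist (φ t') (S.omegaEps T ε x k) < ENNReal.ofReal γ), (t : ℝ≥0∞)

/-- The system possesses `τ₃⁰`-slow relaxations. -/
def HasTauThreeZeroSlowRelaxations (S : SemiflowFamily X K) (T : ℝ≥0) : Prop :=
  ∃ γ : ℝ, 0 < γ ∧ ∃ (ε : ℕ → ℝ) (x : ℕ → X) (k : ℕ → K) (φ : ℕ → ℝ≥0 → X),
    (∀ j, 0 < ε j) ∧ Tendsto ε atTop (𝓝 0) ∧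
    (∀ j, S.IsEpsMotion T (k j) (x j) (ε j) (φ j)) ∧
    Tendsto (fun j => S.tauThree T (ε j) (x j) (k j) (φ j) γ) atTop (𝓝 ∞)

/-- The system possesses `ω⁰(x, k)`-bifurcations: `(x, k) ↦ ω⁰(x, k)` is not lower semicontinuous
on `X × K`. -/
def HasOmegaZeroBifurcations (S : SemiflowFamily X K) (T : ℝ≥0) : Prop :=
  ¬ ∀ z₀ : X × K, LowerSemicontAt (fun z : X × K => S.omegaZero T z.1 z.2) z₀

end SemiflowFamily

/-! Call `y` late-reachable from `x` if for every ε some ε-motions from `x` hit it at arbitrarily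
late times (`LongReach`), and recurrent if it is late-reachable from itself. Motions may jump, so
they can be edited, glued and made periodic at small cost. Hence late reachability is closed and
transitive, and ω⁰(x, k) is exactly the set of recurrent points late-reachable from `x`
(`mem_omegaZero_iff`).

(a) Lower semicontinuity makes every late-reachable point recurrent
(`LongReach.self_of_lowerSemicont`). Under slow relaxation, late far points of motions accumulate at
some `y` late-reachable from a limit `x`. Then `y` lies in ω⁰(x, k), and lower semicontinuity puts
nearby sets ω⁰ close to `y`, a contradiction.

(b) Absence of slow relaxations also makes late-reachable points recurrent
(`LongReach.self_of_not_slow`). On connected `X`, a clopen argument with δ-chains then shows that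
ω⁰(x, k) does not depend on `x` (`longReach_of_recurrent`). If semicontinuity fails at (x₀, k₀),
pull a badly approximated point of ω⁰(x₀, k₀) back by a long time and follow the flow of a nearby
`k` from there: this true orbit is late and still far from ω⁰(·, k), so relaxation is slow after
all. -/

/-- Diagonal compactness device: a limit point of witnesses for ε → 0 has witnesses of every quality
arbitrarily close to it. -/
theorem exists_forall_exists_dist_lt {Y : Type*} [PseudoMetricSpace Y] [CompactSpace Y]
    (Φ : ℝ → Y → Prop) (mono : ∀ ε ε' p, 0 < ε → ε ≤ ε' → Φ ε p → Φ ε' p)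
    (h : ∀ ε, 0 < ε → ∃ p, Φ ε p) :
    ∃ u, ∀ ε, 0 < ε → ∃ p, Φ ε p ∧ dist p u < ε := by
  choose p hp using fun n : ℕ => h (1 / ((n : ℝ) + 1)) Nat.one_div_pos_of_nat
  obtain ⟨u, -, σ, hσ, hu⟩ := isCompact_univ.tendsto_subseq (x := p) fun n => mem_univ _
  refine ⟨u, fun ε hε => ?_⟩
  have h1 : ∀ᶠ n in atTop, dist (p (σ n)) u < ε := hu.eventually (Metric.ball_mem_nhds u hε)
  have h2 : ∀ᶠ n in atTop, 1 / (((σ n : ℕ) : ℝ) + 1) < ε :=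
    (tendsto_one_div_add_atTop_nhds_zero_nat.comp hσ.tendsto_atTop).eventually (gt_mem_nhds hε)
  obtain ⟨n, hn1, hn2⟩ := (h1.and h2).exists
  exact ⟨_, mono _ _ _ Nat.one_div_pos_of_nat hn2.le (hp _), hn1⟩

/-! ### Late reachability and elementary facts on motions -/

namespace SemiflowFamily

variable {X K : Type*} [MetricSpace X] [MetricSpace K]

/-- For every `ε > 0`, the point `y` is hit at arbitrarily late times by `ε`-motions from `x`. -/
def LongReach (S : SemiflowFamily X K) (T : ℝ≥0) (k : K) (x y : X) : Prop :=
  ∀ ε : ℝ, 0 < ε → ∀ N : ℝ≥0, ∃ φ, S.IsEpsMotion T k x ε φ ∧ ∃ t, N ≤ t ∧ φ t = y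

variable {S : SemiflowFamily X K} {T : ℝ≥0} {k : K} {x y z : X} {ε ε' : ℝ} {φ : ℝ≥0 → X}

theorem IsEpsMotion.mono (h : S.IsEpsMotion T k x ε φ) (hε : ε ≤ ε') :
    S.IsEpsMotion T k x ε' φ :=
  ⟨h.1, fun t τ hτ => (h.2 t τ hτ).trans_le hε⟩

theorem IsEpsMotion.shift (h : S.IsEpsMotion T k x ε φ) (s : ℝ≥0) :
    S.IsEpsMotion T k (φ s) ε fun t => φ (s + t) :=
  ⟨by simp, fun t τ hτ => by simpa [add_assoc] using h.2 (s + t) τ hτ⟩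

theorem f_sub_add (S : SemiflowFamily X K) {a b c : ℝ≥0} (h : a + b = c) (x : X) (k : K) :
    S.f a (S.f b x k) k = S.f c x k := by
  rw [S.f_add, h]

theorem isEpsMotion_orbit (S : SemiflowFamily X K) (T : ℝ≥0) (k : K) (x : X) (hε : 0 < ε) :
    S.IsEpsMotion T k x ε fun t => S.f t x k :=
  ⟨S.f_zero x k, fun t τ _ => by
    show dist (S.f (t + τ) x k) (S.f τ (S.f t x k) k) < ε
    rw [S.f_add, add_comm, dist_self]; exact hε⟩

theorem omegaEps_mono (S : SemiflowFamily X K) (T : ℝ≥0) (h : ε ≤ ε') (x : X) (k : K) :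
    S.omegaEps T ε x k ⊆ S.omegaEps T ε' x k :=
  fun _ ⟨φ, hφ, hy⟩ => ⟨φ, hφ.mono h, hy⟩

theorem omegaZero_subset_omegaEps (S : SemiflowFamily X K) (T : ℝ≥0) (hε : 0 < ε) (x : X) (k : K) :
    S.omegaZero T x k ⊆ S.omegaEps T ε x k :=
  iInter₂_subset ε hε

theorem hasTauThreeZeroSlowRelaxations_of_forall {γ : ℝ} (hγ : 0 < γ)
    (h : ∀ ε : ℝ, 0 < ε → ∀ N : ℝ≥0, ∃ ε' x k φ t, 0 < ε' ∧ ε' ≤ ε ∧ S.IsEpsMotion T k x ε' φ ∧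
      N ≤ t ∧ ∀ w ∈ S.omegaEps T ε' x k, γ ≤ dist (φ t) w) :
    S.HasTauThreeZeroSlowRelaxations T := by
  choose ε x k φ t hε hle hφ ht hw using fun n : ℕ =>
    h (1 / ((n : ℝ) + 1)) Nat.one_div_pos_of_nat (n + 1)
  refine ⟨γ, hγ, ε, x, k, φ, hε, squeeze_zero (fun n => (hε n).le) hle
    tendsto_one_div_add_atTop_nhds_zero_nat, hφ, ?_⟩
  refine tendsto_nhds_top_mono ENNReal.tendsto_nat_nhds_top (Eventually.of_forall fun n => ?_)
  refine le_iInf₂ fun s hs => ?_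
  by_contra! hlt
  have hst : s < t n := by
    have h1 : s < (n : ℝ≥0) := by exact_mod_cast hlt
    exact h1.trans_le (le_self_add.trans (ht n))
  refine (hs _ hst).not_ge (Metric.le_infEDist.2 fun w hw' => ?_)
  rw [edist_dist]
  exact ENNReal.ofReal_le_ofReal (hw n w hw')

theorem HasTauThreeZeroSlowRelaxations.exists_far (h : S.HasTauThreeZeroSlowRelaxations T) :
    ∃ γ : ℝ, 0 < γ ∧ ∀ ε : ℝ, 0 < ε → ∀ N : ℝ≥0, ∃ ε' x k φ t, 0 < ε' ∧ ε' ≤ ε ∧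
      S.IsEpsMotion T k x ε' φ ∧ N ≤ t ∧ ∀ w ∈ S.omegaEps T ε' x k, γ ≤ dist (φ t) w := by
  obtain ⟨γ, hγ, ε, x, k, φ, hε, hε0, hφ, hτ⟩ := h
  refine ⟨γ, hγ, fun η hη N => ?_⟩
  obtain ⟨j, hj, hj'⟩ := ((hε0.eventually (gt_mem_nhds hη)).and
    (hτ.eventually (lt_mem_nhds (ENNReal.coe_lt_top (r := N))))).exists
  have : ∃ t, N < t ∧ ENNReal.ofReal γ ≤ Metric.infEDist (φ j t) (S.omegaEps T (ε j) (x j) (k j)) := by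
    by_contra! hcon
    exact hj'.not_ge (iInf₂_le N hcon)
  obtain ⟨t, ht, hd⟩ := this
  refine ⟨ε j, x j, k j, φ j, t, hε j, hj.le, hφ j, ht.le, fun w hw => ?_⟩
  have := hd.trans (Metric.infEDist_le_edist_of_mem hw)
  rwa [edist_dist, ENNReal.ofReal_le_ofReal_iff dist_nonneg] at this

theorem exists_mem_dist_lt_of_lowerSemicontAt {Z : Type*} [TopologicalSpace Z] {F : Z → Set X}
    {z₀ : Z} (h : LowerSemicontAt F z₀) {y : X} (hy : y ∈ F z₀) {γ : ℝ} (hγ : 0 < γ) :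
    ∀ᶠ z in 𝓝 z₀, ∃ w ∈ F z, dist y w < γ := by
  filter_upwards [h.eventually (gt_mem_nhds (ENNReal.ofReal_pos.2 hγ))] with z hz
  have h1 : Metric.infEDist y (F z) < ENNReal.ofReal γ :=
    (le_iSup₂ (f := fun x _ => Metric.infEDist x (F z)) y hy).trans_lt hz
  obtain ⟨w, hw, hd⟩ := Metric.infEDist_lt_iff.1 h1
  rw [edist_dist, ENNReal.ofReal_lt_ofReal_iff hγ] at hd
  exact ⟨w, hw, hd⟩

/-! ### Perturbing, gluing and repeating motions -/

variable [CompactSpace X] [CompactSpace K]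

theorem exists_modulus (S : SemiflowFamily X K) (A : ℝ≥0) (hε : 0 < ε) :
    ∃ δ, 0 < δ ∧ ∀ s ≤ A, ∀ (x x' : X) (k k' : K), dist x x' < δ → dist k k' < δ →
      dist (S.f s x k) (S.f s x' k') < ε := by
  have hc : IsCompact (Icc (0 : ℝ≥0) A ×ˢ (univ : Set (X × K))) := isCompact_Icc.prod isCompact_univ
  have hu := hc.uniformContinuousOn_of_continuous S.continuous_f.continuousOn
  obtain ⟨δ, hδ, h⟩ := Metric.uniformContinuousOn_iff.1 hu ε hε
  refine ⟨δ, hδ, fun s hs x x' k k' hx hk => ?_⟩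
  refine h (s, x, k) (by simp [hs]) (s, x', k') (by simp [hs]) ?_
  simp [Prod.dist_eq, hx, hk]

theorem exists_isEpsMotion_of_dist_lt (S : SemiflowFamily X K) (T : ℝ≥0) (hε : 0 < ε) :
    ∃ δ, 0 < δ ∧ ∀ (k k' : K) (x : X) (φ φ' : ℝ≥0 → X), S.IsEpsMotion T k x δ φ →
      (∀ t, dist (φ t) (φ' t) < δ) → dist k k' < δ → S.IsEpsMotion T k' (φ' 0) ε φ' := by
  obtain ⟨δ, hδ, h⟩ := S.exists_modulus T (ε := ε / 3) (by positivity)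
  refine ⟨min δ (ε / 3), by positivity, fun k k' x φ φ' hφ hd hk => ⟨rfl, fun t τ hτ => ?_⟩⟩
  have h1 := (hd (t + τ)).trans_le (min_le_right _ _)
  have h2 := (hφ.2 t τ hτ).trans_le (min_le_right _ _)
  have h3 := h τ hτ _ _ k k' ((hd t).trans_le (min_le_left _ _)) (hk.trans_le (min_le_left _ _))
  rw [dist_comm] at h1
  linarith [dist_triangle4 (φ' (t + τ)) (φ (t + τ)) (S.f τ (φ t) k) (S.f τ (φ' t) k')]

/-- Comparison of a motion starting at `φ (t + a)` with the true motion started from `φ t`. -/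
theorem exists_junction (S : SemiflowFamily X K) (T : ℝ≥0) (hε : 0 < ε) :
    ∃ δ, 0 < δ ∧ δ ≤ ε ∧ ∀ (k : K) (x y : X) (φ ψ : ℝ≥0 → X) (t a b : ℝ≥0),
      S.IsEpsMotion T k x δ φ → S.IsEpsMotion T k y δ ψ → φ (t + a) = y → a ≤ T → b ≤ T →
      dist (ψ b) (S.f (a + b) (φ t) k) < ε := by
  obtain ⟨δ, hδ, h⟩ := S.exists_modulus T (ε := ε / 2) (by positivity)
  refine ⟨min δ (ε / 2), by positivity, (min_le_right _ _).trans (by linarith),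
    fun k x y φ ψ t a b hφ hψ hy ha hb => ?_⟩
  have h1 := (hψ.2 0 b hb).trans_le (min_le_right _ _)
  rw [zero_add, hψ.1] at h1
  have h2 := h b hb _ _ k k ((hφ.2 t a ha).trans_le (min_le_left _ _)) (by simpa using hδ)
  rw [hy, S.f_add, add_comm b a] at h2
  linarith [dist_triangle (ψ b) (S.f b y k) (S.f (a + b) (φ t) k)]

theorem exists_isEpsMotion_glue (S : SemiflowFamily X K) (T : ℝ≥0) (hε : 0 < ε) :
    ∃ δ, 0 < δ ∧ ∀ (k : K) (x y : X) (φ ψ : ℝ≥0 → X) (s : ℝ≥0),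
      S.IsEpsMotion T k x δ φ → S.IsEpsMotion T k y δ ψ → φ s = y →
      ∃ χ, S.IsEpsMotion T k x ε χ ∧ ∀ t, χ (s + t) = ψ t := by
  obtain ⟨δ, hδ, hδε, h⟩ := S.exists_junction T hε
  refine ⟨δ, hδ, fun k x y φ ψ s hφ hψ hy =>
    ⟨fun t => if t < s then φ t else ψ (t - s), ⟨?_, fun t τ hτ => ?_⟩, fun t => by simp⟩⟩
  · rcases eq_or_ne s 0 with rfl | hs
    · simp [hψ.1, ← hy, hφ.1]
    · simp [pos_iff_ne_zero.2 hs, hφ.1]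
  · by_cases h1 : t + τ < s
    · simp only [h1, if_true, le_self_add.trans_lt h1]
      exact (hφ.2 t τ hτ).trans_le hδε
    · push Not at h1
      by_cases h2 : t < s
      · obtain ⟨a, rfl⟩ := exists_add_of_le h2.le
        obtain ⟨b, rfl⟩ := exists_add_of_le (le_of_add_le_add_left h1)
        simp only [h1.not_gt, if_false, h2, if_true]
        rw [← add_assoc, add_tsub_cancel_left]
        exact h k x y φ ψ t a b hφ hψ hy (le_self_add.trans hτ) (le_add_self.trans hτ)
      · obtain ⟨c, rfl⟩ := exists_add_of_le (not_lt.1 h2)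
        simp only [h1.not_gt, if_false, h2]
        rw [add_assoc, add_tsub_cancel_left, add_tsub_cancel_left]
        exact (hψ.2 c τ hτ).trans_le hδε

/-- Repeat the loop forever. Since `T ≤ p`, a time window of length at most `T` meets at most one
junction, so the errors do not accumulate. -/
theorem exists_isEpsMotion_periodic (S : SemiflowFamily X K) (T : ℝ≥0) (hε : 0 < ε) :
    ∃ δ, 0 < δ ∧ ∀ (k : K) (y : X) (φ : ℝ≥0 → X) (p : ℝ≥0), 0 < p → T ≤ p →
      S.IsEpsMotion T k y δ φ → φ p = y →
      ∃ χ, S.IsEpsMotion T k y ε χ ∧ ∀ n : ℕ, χ (n * p) = y := by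
  obtain ⟨δ, hδ, hδε, h⟩ := S.exists_junction T hε
  refine ⟨δ, hδ, fun k y φ p hp hTp hφ hy => ?_⟩
  let χ : ℝ≥0 → X := fun t => φ (t - ⌊t / p⌋₊ * p)
  have hχ : ∀ (n : ℕ) (r : ℝ≥0), r < p → χ (n * p + r) = φ r := fun n r hr => by
    have : ⌊(n * p + r) / p⌋₊ = n := by
      rw [Nat.floor_eq_iff (by positivity), le_div_iff₀ hp, div_lt_iff₀ hp]
      exact ⟨le_self_add, by rw [add_mul, one_mul]; gcongr⟩
    simp only [χ, this, add_tsub_cancel_left]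
  have hdec : ∀ t : ℝ≥0, ∃ (n : ℕ) (r : ℝ≥0), r < p ∧ t = n * p + r := fun t => by
    have h1 : (⌊t / p⌋₊ : ℝ≥0) * p ≤ t := (le_div_iff₀ hp).1 (Nat.floor_le (by positivity))
    obtain ⟨r, hr⟩ := exists_add_of_le h1
    refine ⟨⌊t / p⌋₊, r, ?_, hr⟩
    have h2 : t < (⌊t / p⌋₊ + 1) * p := (div_lt_iff₀ hp).1 (Nat.lt_floor_add_one _)
    rw [add_mul, one_mul] at h2
    exact lt_of_add_lt_add_left (hr.symm.trans_lt h2)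
  refine ⟨χ, ⟨?_, fun t τ hτ => ?_⟩, fun n => ?_⟩
  · simpa [hφ.1] using hχ 0 0 hp
  · obtain ⟨n, r, hr, rfl⟩ := hdec t
    rw [hχ n r hr, add_assoc]
    by_cases hrp : r + τ < p
    · rw [hχ n _ hrp]
      exact (hφ.2 r τ hτ).trans_le hδε
    · obtain ⟨a, rfl⟩ := exists_add_of_le hr.le
      obtain ⟨b, rfl⟩ := exists_add_of_le (le_of_add_le_add_left (not_lt.1 hrp))
      have hb : b < r + a := by
        rcases eq_or_ne a 0 with rfl | ha
        · simp at hr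
        · exact (lt_add_of_pos_left b (pos_iff_ne_zero.2 ha)).trans_le (hτ.trans hTp)
      have : (n : ℝ≥0) * (r + a) + (r + (a + b)) = (n + 1 : ℕ) * (r + a) + b := by
        push_cast; ring
      rw [this, hχ _ b hb]
      exact h k y y φ φ r a b hφ hφ hy (le_self_add.trans hτ) (le_add_self.trans hτ)
  · simpa [hφ.1] using hχ n 0 hp

/-! ### Calculus of late reachability and the description of ω⁰ -/

/-- Motions need not be continuous, so a nearly correct one can be overwritten at its two end times,
and a small change of parameter is absorbed in the error. -/
theorem LongReach.of_approx
    (h : ∀ ε : ℝ, 0 < ε → ∀ N : ℝ≥0, ∃ x' k' φ t, S.IsEpsMotion T k' x' ε φ ∧ dist x' x < ε ∧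
      dist k' k < ε ∧ N ≤ t ∧ dist (φ t) y < ε) : S.LongReach T k x y := by
  classical
  intro ε hε N
  obtain ⟨δ, hδ, H⟩ := S.exists_isEpsMotion_of_dist_lt T hε
  -- The bound 1 keeps `t` away from 0, so that the two overwritten values do not collide.
  obtain ⟨x', k', φ, t, hφ, hx, hk, ht, hy⟩ := h δ hδ (max N 1)
  have ht0 : t ≠ 0 := (lt_of_lt_of_le one_pos ((le_max_right _ _).trans ht)).ne'
  let φ' := Function.update (Function.update φ t y) 0 x
  have h0 : φ' 0 = x := by simp [φ']
  have h1 : φ' t = y := by simp [φ', ht0]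
  refine ⟨φ', ?_, t, (le_max_left _ _).trans ht, h1⟩
  rw [← h0]
  refine H k' k x' φ φ' hφ (fun s => ?_) hk
  by_cases hs0 : s = 0
  · subst hs0; rwa [h0, hφ.1]
  by_cases hst : s = t
  · subst hst; rwa [h1]
  · simpa [φ', hs0, hst] using hδ

theorem LongReach.trans_approx (h : S.LongReach T k x y)
    (h' : ∀ ε : ℝ, 0 < ε → ∃ φ s, S.IsEpsMotion T k y ε φ ∧ dist (φ s) z < ε) :
    S.LongReach T k x z := by
  refine .of_approx fun ε hε N => ?_
  obtain ⟨δ, hδ, H⟩ := S.exists_isEpsMotion_glue T hε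
  obtain ⟨φ, hφ, s, hs, hy⟩ := h δ hδ N
  obtain ⟨ψ, r, hψ, hr⟩ := h' (min δ ε) (by positivity)
  obtain ⟨χ, hχ, hχ'⟩ := H k x y φ ψ s hφ (hψ.mono (min_le_left _ _)) hy
  exact ⟨x, k, χ, s + r, hχ, by simpa, by simpa, hs.trans le_self_add,
    by rw [hχ']; exact hr.trans_le (min_le_right _ _)⟩

theorem LongReach.trans (h : S.LongReach T k x y) (h' : S.LongReach T k y z) :
    S.LongReach T k x z :=
  h.trans_approx fun ε hε => by
    obtain ⟨φ, hφ, t, -, ht⟩ := h' ε hε 0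
    exact ⟨φ, t, hφ, by simpa [ht]⟩

theorem LongReach.of_forall_dist_lt
    (h : ∀ ε : ℝ, 0 < ε → ∃ x' y', S.LongReach T k x' y' ∧ dist x' x < ε ∧ dist y' y < ε) :
    S.LongReach T k x y :=
  .of_approx fun ε hε N => by
    obtain ⟨x', y', hL, hx, hy⟩ := h ε hε
    obtain ⟨φ, hφ, t, ht, rfl⟩ := hL ε hε N
    exact ⟨x', k, φ, t, hφ, hx, by simpa, ht, hy⟩

/-- A motion from `x` is close to the flow at time `s ≤ T`; drop its beginning. -/
theorem LongReach.flow_left (h : S.LongReach T k x y) {s : ℝ≥0} (hs : s ≤ T) :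
    S.LongReach T k (S.f s x k) y :=
  .of_approx fun ε hε N => by
    obtain ⟨φ, hφ, t, ht, rfl⟩ := h ε hε (s + N)
    obtain ⟨r, rfl⟩ := exists_add_of_le (le_self_add.trans ht)
    have := hφ.2 0 s hs
    rw [zero_add, hφ.1] at this
    exact ⟨φ s, k, _, r, hφ.shift s, this, by simpa, le_of_add_le_add_left ht, by simpa⟩

theorem LongReach.flow_left_mul (h : S.LongReach T k x y) (n : ℕ) :
    S.LongReach T k (S.f (n * T) x k) y := by
  induction n with
  | zero => simpa [S.f_zero] using h
  | succ n ih =>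
    rw [← S.f_sub_add (show T + n * T = (n + 1 : ℕ) * T by push_cast; ring)]
    exact ih.flow_left le_rfl

/-- A motion returns near its ω-limit point infinitely often: one late visit gives reachability, two
visits far apart in time give recurrence. -/
theorem longReach_of_forall_omegaEps
    (h : ∀ ε : ℝ, 0 < ε → ∃ x' k' y', y' ∈ S.omegaEps T ε x' k' ∧ dist x' x < ε ∧ dist k' k < ε ∧
      dist y' y < ε) : S.LongReach T k x y ∧ S.LongReach T k y y := by
  have key : ∀ ε : ℝ, 0 < ε → ∀ N : ℝ≥0, ∃ x' k' φ t r, S.IsEpsMotion T k' x' ε φ ∧ dist x' x < ε ∧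
      dist k' k < ε ∧ N ≤ t ∧ N ≤ r ∧ dist (φ t) y < ε ∧ dist (φ (t + r)) y < ε := fun ε hε N => by
    obtain ⟨x', k', y', ⟨φ, hφ, u, hu, hy⟩, hx, hk, hyy⟩ := h ε hε
    have h1 : ∀ᶠ i in atTop, dist (φ (u i)) y < ε :=
      hy.eventually (Metric.isOpen_ball.mem_nhds (show y' ∈ Metric.ball y ε from hyy))
    obtain ⟨i, hi, hi'⟩ := (h1.and (hu.eventually_ge_atTop N)).exists
    obtain ⟨j, hj, hj'⟩ := (h1.and (hu.eventually_ge_atTop (u i + N))).exists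
    obtain ⟨r, hr⟩ := exists_add_of_le (le_self_add.trans hj')
    rw [hr] at hj hj'
    exact ⟨x', k', φ, u i, r, hφ, hx, hk, hi', le_of_add_le_add_left hj', hi, hj⟩
  constructor
  · refine .of_approx fun ε hε N => ?_
    obtain ⟨x', k', φ, t, r, hφ, hx, hk, ht, -, hy, -⟩ := key ε hε N
    exact ⟨x', k', φ, t, hφ, hx, hk, ht, hy⟩
  · refine .of_approx fun ε hε N => ?_
    obtain ⟨x', k', φ, t, r, hφ, hx, hk, -, hr, hy, hy'⟩ := key ε hε N
    exact ⟨φ t, k', _, r, hφ.shift t, hy, hk, hr, hy'⟩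

theorem mem_omegaZero_iff :
    y ∈ S.omegaZero T x k ↔ S.LongReach T k x y ∧ S.LongReach T k y y := by
  refine ⟨fun h => longReach_of_forall_omegaEps fun ε hε => ⟨x, k, y, mem_iInter₂.1 h ε hε,
    by simpa, by simpa, by simpa⟩, fun ⟨h1, h2⟩ => mem_iInter₂.2 fun ε hε => ?_⟩
  obtain ⟨δ, hδ, H⟩ := S.exists_isEpsMotion_glue T hε
  obtain ⟨η, hη, H'⟩ := S.exists_isEpsMotion_periodic T hδ
  obtain ⟨φ, hφ, s, -, hs⟩ := h1 δ hδ 0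
  obtain ⟨ψ, hψ, p, hp, hp'⟩ := h2 η hη (max 1 T)
  have hp1 : 1 ≤ p := (le_max_left _ _).trans hp
  obtain ⟨χ, hχ, hχ'⟩ := H' k y ψ p (one_pos.trans_le hp1) ((le_max_right _ _).trans hp) hψ hp'
  obtain ⟨ξ, hξ, hξ'⟩ := H k x y φ χ s hφ hχ hs
  refine ⟨ξ, hξ, fun n => s + n * p, ?_, by simp [hξ', hχ']⟩
  refine tendsto_atTop_mono (fun n => ?_) (tendsto_natCast_atTop_atTop (R := ℝ≥0))
  exact le_add_left (le_mul_of_one_le_right (by positivity) hp1)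

theorem mem_omegaZero_of_forall_dist_lt
    (h : ∀ ε : ℝ, 0 < ε → ∃ y', y' ∈ S.omegaEps T ε x k ∧ dist y' y < ε) :
    y ∈ S.omegaZero T x k :=
  mem_omegaZero_iff.2 <| longReach_of_forall_omegaEps fun ε hε => by
    obtain ⟨y', h1, h2⟩ := h ε hε
    exact ⟨x, k, y', h1, by simpa, by simpa, h2⟩

theorem isClosed_omegaZero (S : SemiflowFamily X K) (T : ℝ≥0) (x : X) (k : K) :
    IsClosed (S.omegaZero T x k) := by
  refine isClosed_of_closure_subset fun y hy => mem_omegaZero_of_forall_dist_lt fun ε hε => ?_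
  obtain ⟨y', h, hd⟩ := Metric.mem_closure_iff.1 hy ε hε
  exact ⟨y', S.omegaZero_subset_omegaEps T hε x k h, by rwa [dist_comm]⟩

/-- `ω^ε(x, k)` shrinks to `ω⁰(x, k)` as `ε → 0`. -/
theorem exists_omegaEps_subset (S : SemiflowFamily X K) (T : ℝ≥0) (x : X) (k : K) {γ : ℝ}
    (hγ : 0 < γ) : ∃ ε, 0 < ε ∧ ∀ y ∈ S.omegaEps T ε x k, ∃ w ∈ S.omegaZero T x k, dist y w < γ := by
  by_contra! hcon
  obtain ⟨u, hu⟩ := exists_forall_exists_dist_lt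
    (fun ε y => y ∈ S.omegaEps T ε x k ∧ ∀ w ∈ S.omegaZero T x k, γ ≤ dist y w)
    (fun ε ε' p _ h hp => ⟨S.omegaEps_mono T h x k hp.1, hp.2⟩) hcon
  have huW : u ∈ S.omegaZero T x k := mem_omegaZero_of_forall_dist_lt fun ε hε => by
    obtain ⟨p, hp, hd⟩ := hu ε hε
    exact ⟨p, hp.1, hd⟩
  obtain ⟨p, hp, hd⟩ := hu γ hγ
  exact (hp.2 u huW).not_gt hd

/-- A point reachable at late times has a preimage under the time-`T` shift with this property. -/
theorem LongReach.exists_preimage (h : S.LongReach T k x y) :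
    ∃ u, S.LongReach T k x u ∧ S.f T u k = y := by
  obtain ⟨u, hu⟩ := exists_forall_exists_dist_lt
    -- The bound `1 / ε` ties lateness to accuracy, so a single parameter controls both.
    (fun ε u => ∃ φ t, S.IsEpsMotion T k x ε φ ∧ 1 / ε ≤ (t : ℝ≥0) ∧ φ t = u ∧
      dist y (S.f T u k) < ε)
    (fun ε ε' u hε hle ⟨φ, t, h1, h2, h3, h4⟩ =>
      ⟨φ, t, h1.mono hle, (one_div_le_one_div_of_le hε hle).trans h2, h3, h4.trans_le hle⟩)
    (fun ε hε => by
      obtain ⟨φ, hφ, t, ht, rfl⟩ := h ε hε ((1 / ε).toNNReal + T)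
      obtain ⟨r, rfl⟩ := exists_add_of_le (le_add_self.trans ht)
      rw [add_comm] at ht
      refine ⟨φ r, φ, r, hφ, Real.toNNReal_le_iff_le_coe.1 (le_of_add_le_add_left ht), rfl, ?_⟩
      simpa [add_comm] using hφ.2 r T le_rfl)
  refine ⟨u, .of_approx fun ε hε N => ?_, ?_⟩
  · have hN : (0 : ℝ) < N + 1 := by positivity
    obtain ⟨p, ⟨φ, t, h1, h2, rfl, h4⟩, hd⟩ := hu (min ε (1 / (N + 1))) (by positivity)
    refine ⟨x, k, φ, t, h1.mono (min_le_left _ _), by simpa, by simpa, ?_,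
      hd.trans_le (min_le_left _ _)⟩
    have h5 : (N : ℝ) + 1 ≤ 1 / min ε (1 / (N + 1)) := by
      rw [le_one_div hN (by positivity)]; exact min_le_right _ _
    exact NNReal.coe_le_coe.1 (by linarith)
  · refine (eq_of_forall_dist_le fun ε hε => ?_).symm
    obtain ⟨δ, hδ, H⟩ := S.exists_modulus T (ε := ε / 2) (by positivity)
    obtain ⟨p, ⟨φ, t, h1, h2, rfl, h4⟩, hd⟩ := hu (min δ (ε / 2)) (by positivity)
    have h5 := H T le_rfl _ _ k k (hd.trans_le (min_le_left _ _)) (by simpa)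
    linarith [dist_triangle y (S.f T (φ t) k) (S.f T u k), h4.trans_le (min_le_right _ _)]

theorem LongReach.exists_backward_orbit (h : S.LongReach T k x y) :
    ∃ u : ℕ → X, u 0 = y ∧ (∀ m, S.LongReach T k x (u m)) ∧
      ∀ m n : ℕ, S.f (n * T) (u (m + n)) k = u m := by
  choose g hg using fun p : {y // S.LongReach T k x y} => p.2.exists_preimage
  let v : ℕ → {y // S.LongReach T k x y} := fun n =>
    Nat.rec ⟨y, h⟩ (fun _ p => ⟨g p, (hg p).1⟩) n
  refine ⟨fun n => (v n).1, rfl, fun m => (v m).2, fun m n => ?_⟩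
  induction n with
  | zero => simp [S.f_zero]
  | succ n ih =>
    rw [← S.f_sub_add (show n * T + T = (n + 1 : ℕ) * T by push_cast; ring)]
    have : S.f T (v (m + (n + 1))).1 k = (v (m + n)).1 := (hg (v (m + n))).2
    rw [this, ih]

theorem LongReach.exists_flow_eq (h : S.LongReach T k x y) (n : ℕ) :
    ∃ u, S.f (n * T) u k = y := by
  obtain ⟨u, hu0, -, hu⟩ := h.exists_backward_orbit
  exact ⟨u n, by simpa [hu0] using hu 0 n⟩

/-- True orbits are ε-motions for every ε. -/
theorem longReach_of_frequently_orbit (hT : 0 < T)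
    (h : ∀ ε : ℝ, 0 < ε → ∀ N : ℕ, ∃ (x' : X) (n : ℕ), N ≤ n ∧ dist x' x < ε ∧
      dist (S.f (n * T) x' k) y < ε) : S.LongReach T k x y :=
  .of_approx fun ε hε N => by
    obtain ⟨M, hM⟩ := exists_nat_ge (N / T)
    obtain ⟨x', n, hn, hx, hy⟩ := h ε hε M
    refine ⟨x', k, _, n * T, S.isEpsMotion_orbit T k x' hε, hx, by simpa, ?_, hy⟩
    rw [div_le_iff₀ hT] at hM
    exact hM.trans (by gcongr)

/-- Limit points of a backward orbit of `y`. -/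
theorem LongReach.exists_alpha (hT : 0 < T) (h : S.LongReach T k x y) :
    ∃ (u : ℕ → X) (z : X), (∀ m : ℕ, S.f (m * T) (u m) k = y) ∧ MapClusterPt z atTop u ∧
      S.LongReach T k z z ∧ S.LongReach T k z y := by
  obtain ⟨u, hu0, -, hu⟩ := h.exists_backward_orbit
  obtain ⟨z, -, hz⟩ := isCompact_univ.exists_mapClusterPt (f := atTop) (u := u) (by simp)
  have hfr : ∀ ε : ℝ, 0 < ε → ∀ N : ℕ, ∃ m, N ≤ m ∧ dist (u m) z < ε := fun ε hε N =>
    frequently_atTop.1 (hz.frequently (Metric.ball_mem_nhds z hε)) N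
  refine ⟨u, z, fun m => by simpa [hu0] using hu 0 m, hz,
    longReach_of_frequently_orbit hT fun ε hε N => ?_,
    longReach_of_frequently_orbit hT fun ε hε N => ?_⟩
  · obtain ⟨m, -, hm⟩ := hfr ε hε 0
    obtain ⟨m', hle, hm'⟩ := hfr ε hε (m + N)
    obtain ⟨n, rfl⟩ := exists_add_of_le (le_self_add.trans hle)
    exact ⟨_, n, by omega, hm', by rwa [hu]⟩
  · obtain ⟨m, hm, hd⟩ := hfr ε hε N
    refine ⟨u m, m, hm, hd, ?_⟩
    have := hu 0 m
    rw [zero_add, hu0] at this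
    simpa [this]

/-- Limit points of a forward orbit. -/
theorem exists_omega (S : SemiflowFamily X K) (hT : 0 < T) (x : X) (k : K) :
    ∃ z, S.LongReach T k x z ∧ S.LongReach T k z z ∧
      ∀ w, S.LongReach T k x w → S.LongReach T k z w := by
  obtain ⟨z, -, hz⟩ := (isCompact_univ (X := X)).exists_mapClusterPt (f := atTop)
    (u := fun n : ℕ => S.f (n * T) x k) (by simp)
  have hfr : ∀ ε : ℝ, 0 < ε → ∀ N : ℕ, ∃ m : ℕ, N ≤ m ∧ dist (S.f (m * T) x k) z < ε :=
    fun ε hε N => frequently_atTop.1 (hz.frequently (Metric.ball_mem_nhds z hε)) N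
  refine ⟨z, longReach_of_frequently_orbit hT fun ε hε N => ?_,
    longReach_of_frequently_orbit hT fun ε hε N => ?_, fun w hw =>
    .of_forall_dist_lt fun ε hε => ?_⟩
  · obtain ⟨m, hm, hd⟩ := hfr ε hε N
    exact ⟨x, m, hm, by simpa, hd⟩
  · obtain ⟨m, -, hm⟩ := hfr ε hε 0
    obtain ⟨m', hle, hm'⟩ := hfr ε hε (m + N)
    obtain ⟨n, rfl⟩ := exists_add_of_le (le_self_add.trans hle)
    refine ⟨_, n, by omega, hm, ?_⟩
    rwa [S.f_sub_add (show n * T + m * T = (m + n : ℕ) * T by push_cast; ring)]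
  · obtain ⟨m, -, hm⟩ := hfr ε hε 0
    exact ⟨_, w, hw.flow_left_mul m, hm, by simpa⟩

/-! ### Two sources of recurrence, and part (a) -/

/-- If there are no slow relaxations, then every point that is reachable at late times returns. -/
theorem LongReach.self_of_not_slow (hns : ¬ S.HasTauThreeZeroSlowRelaxations T)
    (h : S.LongReach T k x y) : S.LongReach T k y y := by
  by_contra hy
  have hyW : y ∉ S.omegaZero T x k := fun hy' => hy (mem_omegaZero_iff.1 hy').2
  obtain ⟨γ, hγ, hb⟩ := Metric.nhds_basis_ball.mem_iff.1
    ((S.isClosed_omegaZero T x k).isOpen_compl.mem_nhds hyW)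
  obtain ⟨η, hη, hsub⟩ := S.exists_omegaEps_subset T x k (half_pos hγ)
  refine hns (hasTauThreeZeroSlowRelaxations_of_forall (half_pos hγ) fun ε hε N => ?_)
  obtain ⟨φ, hφ, t, ht, rfl⟩ := h (min ε η) (by positivity) N
  refine ⟨min ε η, x, k, φ, t, by positivity, min_le_left _ _, hφ, ht, fun w hw => ?_⟩
  obtain ⟨v, hv, hwv⟩ := hsub w (S.omegaEps_mono T (min_le_right _ _) x k hw)
  have : γ ≤ dist (φ t) v := by
    by_contra! hlt
    exact hb (show v ∈ Metric.ball (φ t) γ by rwa [Metric.mem_ball, dist_comm]) hv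
  linarith [dist_triangle (φ t) w v]

/-- Let `z` be a limit point of a backward orbit of `y`; it is recurrent and reaches `y`. By
semicontinuity, backward points near `z` reach points near `z`. Flowing them forward to `y` shows
that `y` reaches `z`, closing the loop. -/
theorem LongReach.self_of_lowerSemicont (hT : 0 < T)
    (hlsc : ∀ z₀ : X × K, LowerSemicontAt (fun z : X × K => S.omegaZero T z.1 z.2) z₀)
    (h : S.LongReach T k x y) : S.LongReach T k y y := by
  obtain ⟨u, z, hu, hz, hzz, hzy⟩ := h.exists_alpha hT
  refine LongReach.trans (y := z) (.of_forall_dist_lt fun ε hε => ?_) hzy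
  have h1 := exists_mem_dist_lt_of_lowerSemicontAt (hlsc (z, k))
    (mem_omegaZero_iff.2 ⟨hzz, hzz⟩) hε
  have h2 : ∀ᶠ v in 𝓝 z, ∃ w ∈ S.omegaZero T v k, dist z w < ε :=
    (Continuous.prodMk_left k).continuousAt.eventually h1
  obtain ⟨m, w, hw, hd⟩ := (hz.frequently h2).exists
  have h3 := (mem_omegaZero_iff.1 hw).1.flow_left_mul m
  rw [hu] at h3
  exact ⟨y, w, h3, by simpa, by rwa [dist_comm]⟩

theorem HasTauThreeZeroSlowRelaxations.hasOmegaZeroBifurcations (hT : 0 < T)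
    (h : S.HasTauThreeZeroSlowRelaxations T) : S.HasOmegaZeroBifurcations T := by
  intro hlsc
  obtain ⟨γ, hγ, hfar⟩ := h.exists_far
  obtain ⟨⟨x, k, y⟩, hu⟩ := exists_forall_exists_dist_lt
    (fun ε (p : X × K × X) => ∃ ε' φ t, 0 < ε' ∧ ε' ≤ ε ∧ S.IsEpsMotion T p.2.1 p.1 ε' φ ∧
      1 / ε ≤ (t : ℝ≥0) ∧ φ t = p.2.2 ∧ ∀ w ∈ S.omegaEps T ε' p.1 p.2.1, γ ≤ dist p.2.2 w)
    (fun ε ε' p hε hle ⟨η, φ, t, h1, h2, h3, h4, h5⟩ =>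
      ⟨η, φ, t, h1, h2.trans hle, h3, (one_div_le_one_div_of_le hε hle).trans h4, h5⟩)
    (fun ε hε => by
      obtain ⟨ε', x, k, φ, t, h1, h2, h3, h4, h5⟩ := hfar ε hε (1 / ε).toNNReal
      exact ⟨(x, k, φ t), ε', φ, t, h1, h2, h3, Real.toNNReal_le_iff_le_coe.1 h4, rfl, h5⟩)
  simp only [Prod.exists, Prod.dist_eq, max_lt_iff] at hu
  have hxy : S.LongReach T k x y := .of_approx fun ε hε N => by
    have hN : (0 : ℝ) < N + 1 := by positivity
    obtain ⟨x', k', y', ⟨ε', φ, t, h1, h2, h3, h4, rfl, h5⟩, hx, hk, hy⟩ :=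
      hu (min ε (1 / (N + 1))) (by positivity)
    have hm := min_le_left ε (1 / ((N : ℝ) + 1))
    refine ⟨x', k', φ, t, h3.mono (h2.trans hm), hx.trans_le hm, hk.trans_le hm, ?_,
      hy.trans_le hm⟩
    have h6 : (N : ℝ) + 1 ≤ 1 / min ε (1 / (N + 1)) := by
      rw [le_one_div hN (by positivity)]; exact min_le_right _ _
    exact NNReal.coe_le_coe.1 (by linarith)
  have hev := exists_mem_dist_lt_of_lowerSemicontAt (hlsc (x, k))
    (mem_omegaZero_iff.2 ⟨hxy, hxy.self_of_lowerSemicont hT hlsc⟩) (half_pos hγ)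
  obtain ⟨δ, hδ, H⟩ := Metric.eventually_nhds_iff.1 hev
  obtain ⟨x', k', y', ⟨ε', φ, t, h1, h2, h3, h4, rfl, h5⟩, hx, hk, hy⟩ :=
    hu (min δ (γ / 2)) (by positivity)
  have hm := min_le_left δ (γ / 2)
  obtain ⟨w, hw, hd⟩ := H (y := (x', k')) (max_lt (hx.trans_le hm) (hk.trans_le hm))
  have h6 := h5 w (S.omegaZero_subset_omegaEps T h1 x' k' hw)
  linarith [dist_triangle (φ t) y w, hy.trans_le (min_le_right _ _)]

end SemiflowFamily

/-! ### Chains with small jumps -/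

namespace SemiflowFamily

variable {X K : Type*} [MetricSpace X] [MetricSpace K]

/-- One step of a `δ`-chain: follow the flow for a time in `[T, 2T]`, then jump by less than `δ`. -/
def ChainStep (S : SemiflowFamily X K) (T : ℝ≥0) (k : K) (δ : ℝ) (x y : X) : Prop :=
  ∃ s, T ≤ s ∧ s ≤ T + T ∧ dist y (S.f s x k) < δ

/-- The points that are accessible from `a` by `δ`-chains. -/
def chainSet (S : SemiflowFamily X K) (T : ℝ≥0) (k : K) (δ : ℝ) (a : X) : Set X :=
  {y | Relation.TransGen (S.ChainStep T k δ) a y}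

variable {S : SemiflowFamily X K} {T : ℝ≥0} {k : K} {a p q x y z : X} {δ ε : ℝ} {φ : ℝ≥0 → X}

theorem isOpen_chainSet (S : SemiflowFamily X K) (T : ℝ≥0) (k : K) (δ : ℝ) (a : X) :
    IsOpen (S.chainSet T k δ a) := by
  refine isOpen_iff_mem_nhds.2 fun y hy => ?_
  have key : ∀ p, S.ChainStep T k δ p y → ∀ᶠ z in 𝓝 y, S.ChainStep T k δ p z :=
    fun p ⟨s, h1, h2, h3⟩ => by
      filter_upwards [Metric.isOpen_ball.mem_nhds (show y ∈ Metric.ball (S.f s p k) δ from h3)]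
        with z hz using ⟨s, h1, h2, hz⟩
  cases hy with
  | single h => filter_upwards [key _ h] with z hz using .single hz
  | tail h h' => filter_upwards [key _ h'] with z hz using .tail h hz

/-- Peel off steps of length `T` until the remaining time lies in `[T, 2T]`; this is why chain steps
have lengths in that range. -/
theorem mem_chainSet_of_forall_dist_lt (hT : 0 < T)
    (hε : ∀ t s, s ≤ T + T → dist (φ (t + s)) (S.f s (φ t) k) < δ)
    (h : ∀ t, T ≤ t → t ≤ T + T → φ t ∈ S.chainSet T k δ a) {t : ℝ≥0} (ht : T ≤ t) :
    φ t ∈ S.chainSet T k δ a := by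
  have key : ∀ n : ℕ, ∀ t, T ≤ t → t ≤ n * T + (T + T) → φ t ∈ S.chainSet T k δ a := by
    intro n
    induction n with
    | zero => simpa using h
    | succ n ih =>
      intro t ht ht'
      rcases le_total t (T + T) with h1 | h1
      · exact h t ht h1
      · obtain ⟨r, rfl⟩ := exists_add_of_le (le_self_add.trans h1)
        have h2 : r ≤ n * T + (T + T) := by
          refine le_of_add_le_add_left (a := T) (ht'.trans_eq ?_)
          push_cast; ring
        rw [add_comm T r]
        exact .tail (ih r (le_of_add_le_add_left h1) h2) ⟨T, le_rfl, le_self_add, hε r T le_self_add⟩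
  obtain ⟨n, hn⟩ := exists_nat_ge (t / T)
  exact key n t ht (((div_le_iff₀ hT).1 hn).trans le_self_add)

variable [CompactSpace X] [CompactSpace K]

theorem exists_dist_lt_of_le_add (S : SemiflowFamily X K) (T : ℝ≥0) (hδ : 0 < δ) :
    ∃ ε, 0 < ε ∧ ∀ (k : K) (x : X) (φ : ℝ≥0 → X), S.IsEpsMotion T k x ε φ →
      ∀ t s, s ≤ T + T → dist (φ (t + s)) (S.f s (φ t) k) < δ := by
  obtain ⟨ε, hε, hle, h⟩ := S.exists_junction T hδ
  refine ⟨ε, hε, fun k x φ hφ t s hs => ?_⟩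
  rcases le_total s T with hsT | hsT
  · exact (hφ.2 t s hsT).trans_le hle
  · obtain ⟨b, rfl⟩ := exists_add_of_le hsT
    simpa [add_assoc] using
      h k x _ φ _ t T b hφ (hφ.shift (t + T)) rfl le_rfl (le_of_add_le_add_left hs)

/-- Replacing `p` by a nearby point of the chain set costs only a small error, absorbed in the jump
of the first step. -/
theorem LongReach.mem_chainSet_of_mem_closure (hT : 0 < T) (hδ : 0 < δ)
    (hp : p ∈ closure (S.chainSet T k δ a)) (h : S.LongReach T k p y) :
    y ∈ S.chainSet T k δ a := by
  obtain ⟨ε, hε, H⟩ := S.exists_dist_lt_of_le_add T (half_pos hδ)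
  obtain ⟨η, hη, H'⟩ := S.exists_modulus (T + T) (half_pos hδ)
  obtain ⟨p', hp', hd⟩ := Metric.mem_closure_iff.1 hp η hη
  obtain ⟨φ, hφ, t, ht, rfl⟩ := h ε hε T
  refine mem_chainSet_of_forall_dist_lt hT (fun t s hs => (H k p φ hφ t s hs).trans (half_lt_self hδ))
    (fun t ht ht' => ?_) ht
  refine .tail hp' ⟨t, ht, ht', ?_⟩
  have h1 := H k p φ hφ 0 t ht'
  rw [zero_add, hφ.1] at h1
  linarith [H' t ht' p p' k k hd (by simpa), dist_triangle (φ t) (S.f t p k) (S.f t p' k)]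

theorem LongReach.mem_chainSet (hT : 0 < T) (hδ : 0 < δ) (h : S.LongReach T k a y) :
    y ∈ S.chainSet T k δ a := by
  obtain ⟨ε, hε, H⟩ := S.exists_dist_lt_of_le_add T hδ
  obtain ⟨φ, hφ, t, ht, rfl⟩ := h ε hε T
  refine mem_chainSet_of_forall_dist_lt hT (H k a φ hφ) (fun t ht ht' => .single ⟨t, ht, ht', ?_⟩) ht
  simpa [hφ.1] using H k a φ hφ 0 t ht'

/-- Steps last at least `T`, so a window of length at most `T` sees at most one jump. The induction
carries a motion that ends in a true orbit. -/
theorem exists_isEpsMotion_of_mem_chainSet (S : SemiflowFamily X K) (hT : 0 < T) (hε : 0 < ε) :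
    ∃ δ, 0 < δ ∧ ∀ (k : K) (a y : X), y ∈ S.chainSet T k δ a →
      ∃ φ t, S.IsEpsMotion T k a ε φ ∧ φ t = y := by
  obtain ⟨δ, hδ, H⟩ := S.exists_modulus T hε
  refine ⟨δ, hδ, fun k a y hy => ?_⟩
  have key : ∃ φ t, S.IsEpsMotion T k a ε φ ∧ ∀ s, φ (t + s) = S.f s y k := by
    have step : ∀ p y, S.ChainStep T k δ p y →
        (∃ φ t, S.IsEpsMotion T k a ε φ ∧ ∀ s, φ (t + s) = S.f s p k) →
        ∃ φ t, S.IsEpsMotion T k a ε φ ∧ ∀ s, φ (t + s) = S.f s y k := by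
      rintro p y ⟨s₀, hs, -, hd⟩ ⟨φ, t₀, hφ, hp⟩
      have h0 : 0 < t₀ + s₀ := (hT.trans_le hs).trans_le le_add_self
      refine ⟨fun t => if t < t₀ + s₀ then φ t else S.f (t - (t₀ + s₀)) y k, t₀ + s₀,
        ⟨by simp [h0, hφ.1], fun t τ hτ => ?_⟩, fun s => by simp⟩
      by_cases h1 : t + τ < t₀ + s₀
      · simp only [h1, if_true, le_self_add.trans_lt h1]
        exact hφ.2 t τ hτ
      push Not at h1
      by_cases h2 : t < t₀ + s₀
      · have h3 : t₀ ≤ t := by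
          refine le_of_add_le_add_right (a := T) ?_
          calc t₀ + T ≤ t₀ + s₀ := by gcongr
            _ ≤ t + τ := h1
            _ ≤ t + T := by gcongr
        obtain ⟨c, rfl⟩ := exists_add_of_le h3
        obtain ⟨b, hb⟩ := exists_add_of_le h1
        have hb' : s₀ + b = c + τ := by
          refine add_left_cancel (a := t₀) ?_
          rw [← add_assoc, ← hb, add_assoc]
        have hbT : b ≤ T := by
          refine le_of_add_le_add_left (a := s₀) ?_
          rw [hb']
          exact add_le_add (le_of_add_le_add_left h2.le) hτ
        simp only [h1.not_gt, if_false, h2, if_true]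
        rw [hb, add_tsub_cancel_left, hp, S.f_sub_add (show τ + c = b + s₀ by
          rw [add_comm, ← hb', add_comm]), ← S.f_add]
        exact H b hbT _ _ k k hd (by simpa)
      · obtain ⟨c, rfl⟩ := exists_add_of_le (not_lt.1 h2)
        simp only [h1.not_gt, if_false, h2]
        rw [add_assoc, add_tsub_cancel_left, add_tsub_cancel_left,
          S.f_sub_add (show τ + c = c + τ from add_comm _ _)]
        simpa
    induction hy with
    | single h =>
      exact step _ _ h ⟨_, 0, S.isEpsMotion_orbit T k a hε, fun s => by simp⟩
    | tail _ h ih => exact step _ _ h ih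
  obtain ⟨φ, t, hφ, hs⟩ := key
  exact ⟨φ, t, hφ, by simpa [S.f_zero] using hs 0⟩

/-- If late reachability implies recurrence, then a set `P` accessible by chains cannot be entered
from a recurrent point outside of it. -/
theorem LongReach.mem_chainSet_of_reach (hT : 0 < T) (hδ : 0 < δ)
    (hrec : ∀ x y, S.LongReach T k x y → S.LongReach T k y y) (hx : S.LongReach T k x x)
    (h : S.LongReach T k x y) (hy : y ∈ S.chainSet T k δ a) : x ∈ S.chainSet T k δ a := by
  set P := S.chainSet T k δ a with hP
  by_contra hxP
  -- Each motion from `x` to `y` enters `P` from a point outside within time `T`; `q` is a limit of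
  -- such exit points and `r` of the entry delays. Then `q` is recurrent and flows into `closure P`,
  -- from which it returns to itself, forcing `q ∈ P`.
  obtain ⟨⟨q, r⟩, hu⟩ := exists_forall_exists_dist_lt (Y := X × Icc (0 : ℝ≥0) T)
    (fun ε p => ∃ φ s, S.IsEpsMotion T k x ε φ ∧ φ s = p.1 ∧ p.1 ∉ P ∧ φ (s + p.2) ∈ P)
    (fun ε ε' p _ hle ⟨φ, s, h1, h2⟩ => ⟨φ, s, h1.mono hle, h2⟩)
    (fun ε hε => by
      obtain ⟨φ, hφ, t, -, rfl⟩ := h ε hε 0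
      by_contra! hcon
      have hstep : ∀ s, φ s ∉ P → ∀ τ ≤ T, φ (s + τ) ∉ P := fun s hs τ hτ =>
        hcon (φ s, ⟨τ, zero_le, hτ⟩) φ s hφ rfl hs
      have hall : ∀ n : ℕ, ∀ t ≤ n * T, φ t ∉ P := by
        intro n
        induction n with
        | zero =>
          intro t ht
          obtain rfl : t = 0 := by simpa using ht
          rwa [hφ.1]
        | succ n ih =>
          intro t ht
          rcases le_total t (n * T) with h1 | h1
          · exact ih t h1
          · obtain ⟨τ, rfl⟩ := exists_add_of_le h1
            refine hstep _ (ih _ le_rfl) τ (le_of_add_le_add_left (a := n * T) (ht.trans_eq ?_))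
            push_cast; ring
      obtain ⟨n, hn⟩ := exists_nat_ge (t / T)
      exact hall n t ((div_le_iff₀ hT).1 hn) hy)
  simp only [Prod.exists, Prod.dist_eq, max_lt_iff] at hu
  have hqP : q ∉ P := by
    intro hqP
    obtain ⟨η, hη, hb⟩ := Metric.isOpen_iff.1 (S.isOpen_chainSet T k δ a) q hqP
    obtain ⟨q', r', ⟨φ, s, -, rfl, h2, -⟩, hd, -⟩ := hu η hη
    exact h2 (hb hd)
  have hxq : S.LongReach T k x q := hx.trans_approx fun ε hε => by
    obtain ⟨q', r', ⟨φ, s, h1, rfl, -, -⟩, hd, -⟩ := hu ε hε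
    exact ⟨φ, s, h1, hd⟩
  have hcl : S.f r q k ∈ closure P := by
    refine Metric.mem_closure_iff.2 fun ε hε => ?_
    have hc : Continuous fun p : X × Icc (0 : ℝ≥0) T => S.f p.2 p.1 k :=
      S.continuous_f.comp
        ((continuous_subtype_val.comp continuous_snd).prodMk (continuous_fst.prodMk continuous_const))
    obtain ⟨η, hη, hη'⟩ := Metric.continuous_iff.1 hc (q, r) (ε / 2) (half_pos hε)
    obtain ⟨q', r', ⟨φ, s, h1, rfl, -, h2⟩, hd, hr⟩ := hu (min η (ε / 2)) (by positivity)
    refine ⟨_, h2, ?_⟩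
    have h3 := hη' (φ s, r') (max_lt (hd.trans_le (min_le_left _ _)) (hr.trans_le (min_le_left _ _)))
    have h4 := (h1.2 s r' r'.2.2).trans_le (min_le_right _ _)
    rw [dist_comm] at h3 h4
    exact (dist_triangle _ _ _).trans_lt (by linarith)
  exact hqP (((hrec x q hxq).flow_left r.2.2).mem_chainSet_of_mem_closure hT hδ hcl)

/-! ### Connected phase space and part (b) -/

/-- If `X` is connected and late reachability implies recurrence, then every recurrent point is
reachable from every point. -/
theorem longReach_of_recurrent [PreconnectedSpace X] (hT : 0 < T)
    (hrec : ∀ x y, S.LongReach T k x y → S.LongReach T k y y) (ha : S.LongReach T k a a) (x : X) :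
    S.LongReach T k x a := by
  have main : ∀ δ, 0 < δ → ∀ a, S.LongReach T k a a → ∀ x w, S.LongReach T k x w →
      w ∈ S.chainSet T k δ a := by
    intro δ hδ a ha
    set P := S.chainSet T k δ a with hP
    -- No `x` reaches both `P` and its complement: a forward limit point `u` of `x` is recurrent and
    -- reaches whatever `x` does, so `u` itself falls into `P`.
    have hone : ∀ x v w, S.LongReach T k x v → S.LongReach T k x w → w ∈ P → v ∈ P := by
      intro x v w hv hw hwP
      obtain ⟨u, -, hu, hux⟩ := S.exists_omega hT x k
      have := hu.mem_chainSet_of_reach hT hδ hrec (hux w hw) hwP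
      exact (hux v hv).mem_chainSet_of_mem_closure hT hδ (subset_closure this)
    have hclosed : ∀ A : Set X, IsClosed A → IsClosed {x | ∃ w ∈ A, S.LongReach T k x w} := by
      intro A hA
      refine isClosed_of_closure_subset fun x hx => ?_
      obtain ⟨w, hw⟩ := exists_forall_exists_dist_lt
        (fun ε w => w ∈ A ∧ ∃ x', dist x' x < ε ∧ S.LongReach T k x' w)
        (fun ε ε' w _ hle ⟨h1, x', h2, h3⟩ => ⟨h1, x', h2.trans_le hle, h3⟩)
        (fun ε hε => by
          obtain ⟨x', ⟨w, hw, hL⟩, hd⟩ := Metric.mem_closure_iff.1 hx ε hε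
          exact ⟨w, hw, x', by rwa [dist_comm], hL⟩)
      refine ⟨w, hA.closure_subset (Metric.mem_closure_iff.2 fun ε hε => ?_),
        .of_forall_dist_lt fun ε hε => ?_⟩
      · obtain ⟨w', ⟨h1, -⟩, hd⟩ := hw ε hε
        exact ⟨w', h1, by rwa [dist_comm]⟩
      · obtain ⟨w', ⟨-, x', h2, h3⟩, hd⟩ := hw ε hε
        exact ⟨x', w', h3, h2, hd⟩
    -- Recurrent points of `closure P` already lie in `P`, so the set of points reaching the open
    -- set `P` is closed.
    have hQ1 : {x | ∃ w ∈ P, S.LongReach T k x w} =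
        {x | ∃ w ∈ closure P, S.LongReach T k x w} := by
      ext x
      refine ⟨fun ⟨w, h1, h2⟩ => ⟨w, subset_closure h1, h2⟩, fun ⟨w, h1, h2⟩ => ⟨w, ?_, h2⟩⟩
      exact (hrec x w h2).mem_chainSet_of_mem_closure hT hδ h1
    -- Every point reaches something, so by `hone` the complement consists of the points reaching
    -- the closed set `Pᶜ`.
    have hQ2 : {x | ∃ w ∈ P, S.LongReach T k x w}ᶜ = {x | ∃ w ∈ Pᶜ, S.LongReach T k x w} := by
      ext x
      constructor
      · intro h
        obtain ⟨w, hw, -⟩ := S.exists_omega hT x k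
        exact ⟨w, fun hwP => h ⟨w, hwP, hw⟩, hw⟩
      · rintro ⟨v, hv, hxv⟩ ⟨w, hw, hxw⟩
        exact hv (hone x v w hxv hxw hw)
    have hclopen : IsClopen {x | ∃ w ∈ P, S.LongReach T k x w} :=
      ⟨hQ1 ▸ hclosed _ isClosed_closure, isClosed_compl_iff.1
        (hQ2 ▸ hclosed _ (S.isOpen_chainSet T k δ a).isClosed_compl)⟩
    have huniv := hclopen.eq_univ ⟨a, a, ha.mem_chainSet hT hδ, ha⟩
    intro x v hv
    obtain ⟨w, hw, hxw⟩ : x ∈ {x | ∃ w ∈ P, S.LongReach T k x w} := huniv ▸ mem_univ x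
    exact hone x v w hv hxw hw
  obtain ⟨w, hw, hww, -⟩ := S.exists_omega hT x k
  refine hw.trans (hww.trans_approx fun ε hε => ?_)
  obtain ⟨δ, hδ, H⟩ := S.exists_isEpsMotion_of_mem_chainSet hT hε
  obtain ⟨φ, t, hφ, ht⟩ := H k w a (main δ hδ w hww a a ha)
  exact ⟨φ, t, hφ, by simpa [ht]⟩

theorem HasOmegaZeroBifurcations.hasTauThreeZeroSlowRelaxations [PreconnectedSpace X] (hT : 0 < T)
    (h : S.HasOmegaZeroBifurcations T) : S.HasTauThreeZeroSlowRelaxations T := by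
  by_contra hns
  have hW : ∀ k x y, y ∈ S.omegaZero T x k ↔ S.LongReach T k y y := fun k x y =>
    mem_omegaZero_iff.trans ⟨And.right, fun hy => ⟨longReach_of_recurrent hT
      (fun _ _ hL => hL.self_of_not_slow hns) hy x, hy⟩⟩
  refine h fun ⟨x₀, k₀⟩ => ?_
  refine ENNReal.tendsto_nhds_zero.2 fun c hc => ?_
  obtain ⟨γ, hγ, hγc⟩ : ∃ γ : ℝ, 0 < γ ∧ ENNReal.ofReal γ ≤ c := by
    rcases eq_or_ne c ∞ with rfl | hc'
    · exact ⟨1, one_pos, le_top⟩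
    · exact ⟨c.toReal, ENNReal.toReal_pos hc.ne' hc', by rw [ENNReal.ofReal_toReal hc']⟩
  by_contra hev
  refine hns (hasTauThreeZeroSlowRelaxations_of_forall (γ := γ / 4) (by positivity)
    fun ε hε N => ?_)
  obtain ⟨n, hn⟩ := exists_nat_ge (N / T)
  rw [div_le_iff₀ hT] at hn
  obtain ⟨δ, hδ, H⟩ := S.exists_modulus (n * T) (half_pos hγ)
  have hfr := (not_eventually.1 hev).and_eventually (Metric.ball_mem_nhds (x₀, k₀) hδ)
  obtain ⟨⟨x, k⟩, hlt, hd⟩ := hfr.exists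
  have hk : dist k₀ k < δ := by
    rw [dist_comm]; exact (le_max_right (dist x x₀) _).trans_lt hd
  obtain ⟨y, hy, hyd⟩ : ∃ y ∈ S.omegaZero T x₀ k₀,
      ENNReal.ofReal γ < Metric.infEDist y (S.omegaZero T x k) := by
    by_contra! hcon
    exact hlt ((iSup₂_le hcon).trans hγc)
  obtain ⟨u, rfl⟩ := (mem_omegaZero_iff.1 hy).1.exists_flow_eq n
  obtain ⟨η, hη, hsub⟩ := S.exists_omegaEps_subset T u k (γ := γ / 4) (by positivity)
  refine ⟨min ε η, u, k, _, n * T, by positivity, min_le_left _ _,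
    S.isEpsMotion_orbit T k u (by positivity), hn, fun w hw => ?_⟩
  obtain ⟨v, hv, hwv⟩ := hsub w (S.omegaEps_mono T (min_le_right _ _) u k hw)
  -- Independence of the starting point moves `v` from ω⁰(u, k) to ω⁰(x, k); of the gap γ, the
  -- parameter change uses γ/2 and the passage from ω^ε to ω⁰ uses γ/4.
  have hv' : v ∈ S.omegaZero T x k := (hW k x v).2 ((hW k u v).1 hv)
  have h1 := hyd.trans_le (Metric.infEDist_le_edist_of_mem hv')
  rw [edist_dist, ENNReal.ofReal_lt_ofReal_iff_of_nonneg hγ.le] at h1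
  have h2 := H (n * T) le_rfl u u k₀ k (by simpa) hk
  linarith [dist_triangle4 (S.f (n * T) u k₀) (S.f (n * T) u k) w v]

end SemiflowFamily

theorem theorem4p2 {X K : Type*} [MetricSpace X] [CompactSpace X] [MetricSpace K] [CompactSpace K]
    (S : SemiflowFamily X K) (T : ℝ≥0) (hT : 0 < T) :
    (S.HasTauThreeZeroSlowRelaxations T → S.HasOmegaZeroBifurcations T) ∧
    (PreconnectedSpace X →
      (S.HasTauThreeZeroSlowRelaxations T ↔ S.HasOmegaZeroBifurcations T)) :=
  ⟨fun h => h.hasOmegaZeroBifurcations hT, fun _ =>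
    ⟨fun h => h.hasOmegaZeroBifurcations hT, fun h => h.hasTauThreeZeroSlowRelaxations hT⟩⟩
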